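/- Let $p>1$, let $\mathscr X\subseteq\mathbb R^d$ be a Borel set, and let $\mu$ be a probability measure on $\mathbb R^d$ with $\mu(\mathbb R^d\setminus\mathscr X)=0$ (for instance, $\mathscr X$ is the support of $\mu$). For each $x\in\mathscr X$ let $\mathscr M(x)$ be a symmetric non-negative definite real $p\times p$ matrix. Denote by $\|\mathbf M\|=\mathrm{tr}^{1/2}(\mathbf M\mathbf M^\top)$ the Frobenius norm and by $\lambda_{\min},\lambda_{\max}$ the smallest and largest eigenvalues. Assume $H_{\mathscr M}$: (i) $\mathscr M$ is continuous on $\mathscr X$, and $\int_{\mathscr X}\|\mathscr M(x)\|^2\,\mu(dx)<B$ for some $B<\infty$; (ii) for every $\epsilon>0$ there is $\ell_\epsilon>0$ such that $\lambda_{\min}\big(\int_{A}\mathscr M(x)\,\mu(dx)\big)>\ell_\epsilon$ for every measurable $A\subseteq\mathscr X$ with $\mu(A)=\epsilon$. Then for every $\epsilon>0$ there are (deterministic) constants $\ell>0$ and $L<\infty$, depending only on $\mu$, $\mathscr X$, $\mathscr M$ and $\epsilon$, such that the following holds for every sequence $X_1,X_2,\ldots$ of independent random vectors with law $\mu$. Almost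 surely, for every choice of index sets $S_k\subseteq\{1,\ldots,k\}$, $k\ge 1$ (which may depend on the realization of the whole sequence), whose cardinalities $n_k=\# S_k$ satisfy $n_k/k>\epsilon$ for all sufficiently large $k$, the matrices $\mathbf M_{n_k}=\frac1{n_k}\sum_{i\in S_k}\mathscr M(X_i)$ satisfy $$\liminf_{k\to\infty}\lambda_{\min}(\mathbf M_{n_k})>\ell\qquad\text{and}\qquad \limsup_{k\to\infty}\lambda_{\max}(\mathbf M_{n_k})<L .$$ -/

import Mathlib

open MeasureTheory ProbabilityTheory Filter

noncomputable section

/-- Smallest eigenvalue `λ_min(A)` of a (symmetric) real matrix: the minimum of its real spectrum. -/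
def lambdaMin {p : ℕ} (A : Matrix (Fin p) (Fin p) ℝ) : ℝ := sInf (spectrum ℝ A)

/-- Largest eigenvalue `λ_max(A)` of a (symmetric) real matrix: the maximum of its real spectrum. -/
def lambdaMax {p : ℕ} (A : Matrix (Fin p) (Fin p) ℝ) : ℝ := sSup (spectrum ℝ A)

/-- Frobenius norm `‖A‖ = tr^{1/2}(A Aᵀ)`. -/
def frobeniusNorm {p : ℕ} (A : Matrix (Fin p) (Fin p) ℝ) : ℝ := √(A * A.transpose).trace

/-- The information matrix `M(ξ) = ∫ 𝓜(x) ξ(dx)`, integrated entry by entry. -/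
def infoMatrix {d p : ℕ} (𝓜 : EuclideanSpace ℝ (Fin d) → Matrix (Fin p) (Fin p) ℝ)
    (ξ : Measure (EuclideanSpace ℝ (Fin d))) : Matrix (Fin p) (Fin p) ℝ :=
  Matrix.of fun i j => ∫ x, 𝓜 x i j ∂ξ

/-- Assumption `H_𝓜` on a measure `μ` carried by `𝒳` and the elementary information matrices
`𝓜(x)`, `x ∈ 𝒳`. -/
structure HypM {d p : ℕ} (𝒳 : Set (EuclideanSpace ℝ (Fin d)))
    (μ : Measure (EuclideanSpace ℝ (Fin d)))
    (𝓜 : EuclideanSpace ℝ (Fin d) → Matrix (Fin p) (Fin p) ℝ) : Prop where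
  /-- (i), first part: `𝓜` is continuous on `𝒳`. -/
  continuousOn : ContinuousOn 𝓜 𝒳
  /-- (i), second part: `∫_𝒳 ‖𝓜(x)‖² μ(dx) < B < ∞` for some `B`. -/
  secondMoment : ∃ B : ℝ,
    ∫⁻ x in 𝒳, ENNReal.ofReal (frobeniusNorm (𝓜 x) ^ 2) ∂μ < ENNReal.ofReal B
  /-- (ii): for each `ε > 0` there is `ℓ_ε > 0` such that every measurable subset of `𝒳` of
  measure `ε` carries information with smallest eigenvalue larger than `ℓ_ε`. -/
  nondegenerate : ∀ ε : ℝ, 0 < ε → ∃ ℓ : ℝ, 0 < ℓ ∧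
    ∀ A : Set (EuclideanSpace ℝ (Fin d)), MeasurableSet A → A ⊆ 𝒳 → μ.real A = ε →
      ℓ < lambdaMin (infoMatrix 𝓜 (μ.restrict A))

/-- The normalised information matrix `(1 / n) ∑_{i ∈ S} 𝓜(x_i)`, `n = #S`, of the points of the
sequence `x` whose indices belong to `S`. -/
def designMatrix {d p : ℕ} (𝓜 : EuclideanSpace ℝ (Fin d) → Matrix (Fin p) (Fin p) ℝ)
    (x : ℕ → EuclideanSpace ℝ (Fin d)) (S : Finset ℕ) : Matrix (Fin p) (Fin p) ℝ :=
  (1 / (S.card : ℝ)) • ∑ i ∈ S, 𝓜 (x i)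

end

/-! For a unit vector `v`, the form `v ⬝ᵥ 𝓜 x *ᵥ v` vanishes only on a μ-null part of `𝒳`: on a set
of positive measure it would make the integrated matrix singular, against (ii). So it exceeds some
`δ > 0` outside a set of measure below `ε / 2`. By the strong law fewer than `ε k / 2` of the first
`k` points eventually fall in that set, and any `S k` with more than `ε k` indices keeps over half
of them where the form exceeds `δ`. Compactness reduces the unit sphere to finitely many directions.

Uniformity in `S` comes from bounding sums of nonnegative terms over `S` by sums over all of `range
k`: the strong law is applied to finitely many functions independent of `S`, so one null event
serves every choice. The two estimates are `le_dotProduct_designMatrix_mulVec` and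
`dotProduct_designMatrix_mulVec_le`. -/

open scoped Matrix

/-! ### Quadratic forms on the unit sphere and extreme eigenvalues -/

section QuadraticForm

variable {p : ℕ} {A : Matrix (Fin p) (Fin p) ℝ}

theorem abs_le_one_of_dotProduct_self {v : Fin p → ℝ} (hv : v ⬝ᵥ v = 1) (i : Fin p) :
    |v i| ≤ 1 := by
  have h : v i * v i ≤ v ⬝ᵥ v :=
    Finset.single_le_sum (f := fun i => v i * v i) (fun i _ => mul_self_nonneg _) (Finset.mem_univ i)
  exact abs_le_one_iff_mul_self_le_one.2 (hv ▸ h)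

theorem isCompact_dotProduct_self_eq_one (p : ℕ) : IsCompact {v : Fin p → ℝ | v ⬝ᵥ v = 1} :=
  (isCompact_univ_pi fun _ : Fin p => isCompact_Icc (a := (-1 : ℝ)) (b := 1)).of_isClosed_subset
    (isClosed_eq (by simp only [dotProduct]; fun_prop) continuous_const)
    fun _ hv i _ => abs_le.1 (abs_le_one_of_dotProduct_self hv i)

theorem dotProduct_mulVec_eq_sum (A : Matrix (Fin p) (Fin p) ℝ) (v : Fin p → ℝ) :
    v ⬝ᵥ A *ᵥ v = ∑ i, ∑ j, A i j * (v i * v j) := by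
  simp only [dotProduct, Matrix.mulVec, Finset.mul_sum]
  exact Finset.sum_congr rfl fun i _ => Finset.sum_congr rfl fun j _ => by ring

theorem dotProduct_mulVec_le_sum_abs (A : Matrix (Fin p) (Fin p) ℝ) {v : Fin p → ℝ}
    (hv : v ⬝ᵥ v = 1) : v ⬝ᵥ A *ᵥ v ≤ ∑ i, ∑ j, |A i j| := by
  rw [dotProduct_mulVec_eq_sum]
  refine Finset.sum_le_sum fun i _ => Finset.sum_le_sum fun j _ => (le_abs_self _).trans ?_
  rw [abs_mul, abs_mul]
  exact mul_le_of_le_one_right (abs_nonneg _) (mul_le_one₀ (abs_le_one_of_dotProduct_self hv i)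
    (abs_nonneg _) (abs_le_one_of_dotProduct_self hv j))

/-- Transfers a lower bound from a net point `u` to a nearby `v`; `dist` is the sup distance, and
unit vectors have entries at most 1 in absolute value. -/
theorem dotProduct_mulVec_sub_le (A : Matrix (Fin p) (Fin p) ℝ) {u v : Fin p → ℝ}
    (hu : u ⬝ᵥ u = 1) (hv : v ⬝ᵥ v = 1) :
    u ⬝ᵥ A *ᵥ u - v ⬝ᵥ A *ᵥ v ≤ 2 * dist v u * ∑ i, ∑ j, |A i j| := by
  rw [dotProduct_mulVec_eq_sum, dotProduct_mulVec_eq_sum]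
  simp only [← Finset.sum_sub_distrib, Finset.mul_sum]
  refine Finset.sum_le_sum fun i _ => Finset.sum_le_sum fun j _ => (le_abs_self _).trans ?_
  rw [← mul_sub, abs_mul, mul_comm]
  refine mul_le_mul_of_nonneg_right ?_ (abs_nonneg _)
  have h (i : Fin p) : |u i - v i| ≤ dist v u := by
    rw [dist_comm, ← Real.dist_eq]; exact dist_le_pi_dist u v i
  calc |u i * u j - v i * v j| = |u i * (u j - v j) + (u i - v i) * v j| := by congr 1; ring
    _ ≤ |u i| * |u j - v j| + |u i - v i| * |v j| := by
      rw [← abs_mul, ← abs_mul]; exact abs_add_le _ _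
    _ ≤ 1 * dist v u + dist v u * 1 := by
      gcongr
      · exact abs_le_one_of_dotProduct_self hu i
      · exact h j
      · exact h i
      · exact abs_le_one_of_dotProduct_self hv j
    _ = 2 * dist v u := by ring

theorem exists_dotProduct_mulVec_eq_of_mem_spectrum {r : ℝ} (hr : r ∈ spectrum ℝ A) :
    ∃ v : Fin p → ℝ, v ⬝ᵥ v = 1 ∧ v ⬝ᵥ A *ᵥ v = r := by
  rw [← Matrix.spectrum_toLin', ← Module.End.hasEigenvalue_iff_mem_spectrum] at hr
  obtain ⟨w, hw⟩ := hr.exists_hasEigenvector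
  have hw1 : A *ᵥ w = r • w := by simpa using hw.apply_eq_smul
  have hpos : 0 < w ⬝ᵥ w := by
    have h0 : 0 ≤ w ⬝ᵥ w := Finset.sum_nonneg fun i _ => mul_self_nonneg _
    exact h0.lt_of_ne' fun h => hw.2 (dotProduct_self_eq_zero.1 h)
  have hs : (√(w ⬝ᵥ w))⁻¹ * ((√(w ⬝ᵥ w))⁻¹ * (w ⬝ᵥ w)) = 1 := by
    rw [← mul_assoc, ← mul_inv, Real.mul_self_sqrt hpos.le, inv_mul_cancel₀ hpos.ne']
  have h1 : ((√(w ⬝ᵥ w))⁻¹ • w) ⬝ᵥ ((√(w ⬝ᵥ w))⁻¹ • w) = 1 := by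
    simpa [smul_dotProduct, dotProduct_smul] using hs
  refine ⟨_, h1, ?_⟩
  rw [Matrix.mulVec_smul, hw1, smul_comm, dotProduct_smul, h1]
  simp

theorem Matrix.IsHermitian.spectrum_nonempty (hp : 0 < p) (hA : A.IsHermitian) :
    (spectrum ℝ A).Nonempty := by
  have : Nonempty (Fin p) := ⟨⟨0, hp⟩⟩
  rw [hA.spectrum_real_eq_range_eigenvalues]
  exact Set.range_nonempty _

theorem exists_dotProduct_mulVec_eq_lambdaMin (hp : 0 < p) (hA : A.IsHermitian) :
    ∃ v : Fin p → ℝ, v ⬝ᵥ v = 1 ∧ v ⬝ᵥ A *ᵥ v = lambdaMin A :=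
  exists_dotProduct_mulVec_eq_of_mem_spectrum
    ((hA.spectrum_nonempty hp).csInf_mem A.finite_real_spectrum)

theorem exists_dotProduct_mulVec_eq_lambdaMax (hp : 0 < p) (hA : A.IsHermitian) :
    ∃ v : Fin p → ℝ, v ⬝ᵥ v = 1 ∧ v ⬝ᵥ A *ᵥ v = lambdaMax A :=
  exists_dotProduct_mulVec_eq_of_mem_spectrum
    ((hA.spectrum_nonempty hp).csSup_mem A.finite_real_spectrum)

/-- A positive semidefinite form vanishes only on the kernel, so 0 is an eigenvalue. -/
theorem lambdaMin_nonpos_of_dotProduct_mulVec_eq_zero (hA : A.PosSemidef) {v : Fin p → ℝ}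
    (hv : v ≠ 0) (h : v ⬝ᵥ A *ᵥ v = 0) : lambdaMin A ≤ 0 := by
  have h0 : A *ᵥ v = 0 := (hA.dotProduct_mulVec_zero_iff v).1 (by simpa using h)
  refine csInf_le A.finite_real_spectrum.bddBelow ?_
  rw [← Matrix.spectrum_toLin', ← Module.End.hasEigenvalue_iff_mem_spectrum]
  exact Module.End.hasEigenvalue_of_hasEigenvector
    ⟨Module.End.mem_eigenspace_iff.2 (by simp [h0]), hv⟩

theorem Matrix.PosSemidef.zero_le_quadratic (hA : A.PosSemidef) (v : Fin p → ℝ) :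
    0 ≤ v ⬝ᵥ A *ᵥ v := by
  simpa using hA.dotProduct_mulVec_nonneg v

end QuadraticForm

/-! ### Deterministic bounds for subsamples -/

section Design

variable {d p : ℕ} {M : EuclideanSpace ℝ (Fin d) → Matrix (Fin p) (Fin p) ℝ}

theorem posSemidef_designMatrix (hpsd : ∀ x, (M x).PosSemidef)
    (x : ℕ → EuclideanSpace ℝ (Fin d)) (S : Finset ℕ) : (designMatrix M x S).PosSemidef :=
  (Matrix.posSemidef_sum S fun i _ => hpsd (x i)).smul (by positivity)

theorem card_mul_dotProduct_designMatrix_mulVec (x : ℕ → EuclideanSpace ℝ (Fin d))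
    (S : Finset ℕ) (v : Fin p → ℝ) :
    (S.card : ℝ) * (v ⬝ᵥ designMatrix M x S *ᵥ v) = ∑ i ∈ S, v ⬝ᵥ M (x i) *ᵥ v := by
  rcases S.eq_empty_or_nonempty with rfl | hS
  · simp
  have : (S.card : ℝ) ≠ 0 := by exact_mod_cast hS.card_pos.ne'
  rw [designMatrix, Matrix.smul_mulVec, dotProduct_smul, Matrix.sum_mulVec, dotProduct_sum,
    smul_eq_mul, ← mul_assoc, mul_one_div_cancel this, one_mul]

theorem dotProduct_designMatrix_mulVec_le {x : ℕ → EuclideanSpace ℝ (Fin d)} {S : Finset ℕ}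
    {k : ℕ} {ε C : ℝ} (hε : 0 < ε) (hC : 0 < C) (hk : 0 < k) (hS : S ⊆ Finset.range k)
    (hcard : ε < (S.card : ℝ) / k)
    (hN : (∑ l ∈ Finset.range k, ∑ i, ∑ j, |M (x l) i j|) / k < C)
    {v : Fin p → ℝ} (hv : v ⬝ᵥ v = 1) : v ⬝ᵥ designMatrix M x S *ᵥ v ≤ C / ε := by
  have hk' : (0 : ℝ) < k := by exact_mod_cast hk
  rw [lt_div_iff₀ hk'] at hcard
  rw [div_lt_iff₀ hk'] at hN
  have hn : (0 : ℝ) < S.card := (by positivity : (0 : ℝ) < ε * k).trans hcard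
  have h1 : (S.card : ℝ) * (v ⬝ᵥ designMatrix M x S *ᵥ v) ≤ C * k := by
    rw [card_mul_dotProduct_designMatrix_mulVec]
    refine (Finset.sum_le_sum fun l _ => dotProduct_mulVec_le_sum_abs _ hv).trans
      (le_trans ?_ hN.le)
    exact Finset.sum_le_sum_of_subset_of_nonneg hS fun l _ _ => by positivity
  refine le_of_mul_le_mul_left (h1.trans ?_) hn
  calc C * k = C / ε * (ε * k) := by field_simp
    _ ≤ C / ε * S.card := by gcongr
    _ = _ := mul_comm _ _

/-- Fewer than half the indices in `S` are bad for `u`, so the average form at `u` is at least `δ /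
2`. The radius `δ * ε / (8 * C)` makes the passage to `v` cost at most `δ / 4`. -/
theorem le_dotProduct_designMatrix_mulVec (hpsd : ∀ x, (M x).PosSemidef)
    {x : ℕ → EuclideanSpace ℝ (Fin d)} {S : Finset ℕ}
    {k : ℕ} {ε C δ : ℝ} (hε : 0 < ε) (hC : 0 < C) (hδ : 0 < δ) (hk : 0 < k)
    (hS : S ⊆ Finset.range k) (hcard : ε < (S.card : ℝ) / k)
    (hN : (∑ l ∈ Finset.range k, ∑ i, ∑ j, |M (x l) i j|) / k < C)
    {u v : Fin p → ℝ} (hu : u ⬝ᵥ u = 1) (hv : v ⬝ᵥ v = 1)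
    (hI : (∑ l ∈ Finset.range k,
      {y | u ⬝ᵥ M y *ᵥ u ≤ δ}.indicator (fun _ => (1 : ℝ)) (x l)) / k < ε / 2)
    (huv : dist v u ≤ δ * ε / (8 * C)) : δ / 4 ≤ v ⬝ᵥ designMatrix M x S *ᵥ v := by
  have hk' : (0 : ℝ) < k := by exact_mod_cast hk
  rw [lt_div_iff₀ hk'] at hcard
  rw [div_lt_iff₀ hk'] at hN hI
  have hn : (0 : ℝ) < S.card := (by positivity : (0 : ℝ) < ε * k).trans hcard
  have hNS : ∑ l ∈ S, ∑ i, ∑ j, |M (x l) i j| ≤ C * k :=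
    (Finset.sum_le_sum_of_subset_of_nonneg hS fun l _ _ => by positivity).trans hN.le
  have hIS : ∑ l ∈ S, {y | u ⬝ᵥ M y *ᵥ u ≤ δ}.indicator (fun _ => (1 : ℝ)) (x l) ≤ ε / 2 * k :=
    (Finset.sum_le_sum_of_subset_of_nonneg hS fun l _ _ =>
      Set.indicator_nonneg (fun _ _ => zero_le_one) _).trans hI.le
  have hterm (l : ℕ) : δ - δ * {y | u ⬝ᵥ M y *ᵥ u ≤ δ}.indicator (fun _ => (1 : ℝ)) (x l)
      - 2 * (δ * ε / (8 * C)) * ∑ i, ∑ j, |M (x l) i j| ≤ v ⬝ᵥ M (x l) *ᵥ v := by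
    have h1 := dotProduct_mulVec_sub_le (M (x l)) hu hv
    have h2 : 2 * dist v u * ∑ i, ∑ j, |M (x l) i j| ≤
        2 * (δ * ε / (8 * C)) * ∑ i, ∑ j, |M (x l) i j| := by gcongr
    -- Bad points contribute at least 0 by semidefiniteness, the others more than `δ`.
    have h3 : δ - δ * {y | u ⬝ᵥ M y *ᵥ u ≤ δ}.indicator (fun _ => (1 : ℝ)) (x l)
        ≤ u ⬝ᵥ M (x l) *ᵥ u := by
      by_cases h : x l ∈ {y | u ⬝ᵥ M y *ᵥ u ≤ δ}
      · simpa [Set.indicator_of_mem h] using (hpsd (x l)).zero_le_quadratic u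
      · rw [Set.indicator_of_notMem h]
        simpa using (not_le.1 h).le
    linarith
  have hsum := Finset.sum_le_sum fun l (_ : l ∈ S) => hterm l
  rw [Finset.sum_sub_distrib, Finset.sum_sub_distrib, ← Finset.mul_sum, ← Finset.mul_sum,
    Finset.sum_const, nsmul_eq_mul, ← card_mul_dotProduct_designMatrix_mulVec] at hsum
  refine le_of_mul_le_mul_left (le_trans ?_ hsum) hn
  have e1 : δ * ∑ l ∈ S, {y | u ⬝ᵥ M y *ᵥ u ≤ δ}.indicator (fun _ => (1 : ℝ)) (x l)
      ≤ δ * (S.card / 2) := by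
    gcongr; linarith
  have e2 : 2 * (δ * ε / (8 * C)) * ∑ l ∈ S, ∑ i, ∑ j, |M (x l) i j| ≤ δ * (S.card / 4) := by
    calc _ ≤ 2 * (δ * ε / (8 * C)) * (C * k) := by gcongr
      _ = δ * (ε * k / 4) := by field_simp; ring
      _ ≤ _ := by gcongr
  linarith

theorem measurable_dotProduct_mulVec (hmeas : ∀ i j, Measurable fun x => M x i j)
    (v : Fin p → ℝ) : Measurable fun x => v ⬝ᵥ M x *ᵥ v := by
  simp only [dotProduct_mulVec_eq_sum]
  fun_prop

/-- Continuity from above: the sublevel sets decrease to the null zero set. -/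
theorem exists_measureReal_le_lt {μ : Measure (EuclideanSpace ℝ (Fin d))} [IsFiniteMeasure μ]
    {f : EuclideanSpace ℝ (Fin d) → ℝ} (hf : Measurable f) (hf0 : ∀ x, 0 ≤ f x)
    (hnull : μ {x | f x = 0} = 0) {η : ℝ} (hη : 0 < η) :
    ∃ δ : ℝ, 0 < δ ∧ μ.real {x | f x ≤ δ} < η := by
  have hInter : ⋂ n : ℕ, {x | f x ≤ 1 / ((n : ℝ) + 1)} = {x | f x = 0} := by
    ext x
    simp only [Set.mem_iInter, Set.mem_ofPred_eq]
    refine ⟨fun h => le_antisymm ?_ (hf0 x), fun h n => h ▸ by positivity⟩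
    exact ge_of_tendsto' tendsto_one_div_add_atTop_nhds_zero_nat h
  have ht := tendsto_measure_iInter_atTop (μ := μ)
    (s := fun n : ℕ => {x | f x ≤ 1 / ((n : ℝ) + 1)})
    (fun n => (measurableSet_le hf measurable_const).nullMeasurableSet)
    (fun m n hmn x (hx : f x ≤ _) => hx.trans (by gcongr)) ⟨0, measure_ne_top _ _⟩
  rw [hInter, hnull] at ht
  obtain ⟨n, hn⟩ := (ht.eventually_lt_const (ENNReal.ofReal_pos.2 hη)).exists
  exact ⟨_, by positivity, (ENNReal.lt_ofReal_iff_toReal_lt (measure_ne_top _ _)).1 hn⟩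

end Design

/-! ### Strong law and uniformity over subsamples -/

theorem ae_tendsto_average {Ω E : Type*} [MeasurableSpace Ω] [MeasurableSpace E] {P : Measure Ω}
    {μ : Measure E} {X : ℕ → Ω → E} (hX : ∀ i, HasLaw (X i) μ P)
    (hindep : iIndepFun X P) {f : E → ℝ} (hf : Measurable f) (hint : Integrable f μ) :
    ∀ᵐ ω ∂P, Tendsto (fun k : ℕ => (∑ i ∈ Finset.range k, f (X i ω)) / k) atTop
      (nhds (∫ x, f x ∂μ)) := by
  have h := strong_law_ae_real (μ := P) (fun i ω => f (X i ω))
    (((hX 0).map_eq ▸ hint).comp_aemeasurable (hX 0).aemeasurable)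
    (fun i j hij => (hindep.indepFun hij).comp hf hf)
    (fun i => ((hX i).identDistrib (hX 0)).comp hf)
  have he : ∫ ω, f (X 0 ω) ∂P = ∫ x, f x ∂μ :=
    (hX 0).integral_comp hint.aestronglyMeasurable
  rwa [he] at h

/-- Uniform bounds for the design matrices of subsamples, when the elementary information matrices
are defined, positive semidefinite and measurable on the whole space. -/
theorem exists_bounds_designMatrix {d p : ℕ} (hp : 0 < p)
    {μ : Measure (EuclideanSpace ℝ (Fin d))} [IsProbabilityMeasure μ]
    {M : EuclideanSpace ℝ (Fin d) → Matrix (Fin p) (Fin p) ℝ}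
    (hpsd : ∀ x, (M x).PosSemidef) (hmeas : ∀ i j, Measurable fun x => M x i j)
    (hint : ∀ i j, Integrable (fun x => M x i j) μ)
    (hnull : ∀ v : Fin p → ℝ, v ⬝ᵥ v = 1 → μ {x | v ⬝ᵥ M x *ᵥ v = 0} = 0)
    {ε : ℝ} (hε : 0 < ε) :
    ∃ ℓ L : ℝ, 0 < ℓ ∧
      ∀ (Ω : Type*) [MeasurableSpace Ω] (P : Measure Ω)
        (X : ℕ → Ω → EuclideanSpace ℝ (Fin d)),
        (∀ i, HasLaw (X i) μ P) → iIndepFun X P →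
        ∀ᵐ ω ∂P, ∀ S : ℕ → Finset ℕ,
          (∀ k, S k ⊆ Finset.range k) →
          (∀ᶠ k in atTop, ε < ((S k).card : ℝ) / (k : ℝ)) →
          ∀ᶠ k in atTop, ℓ ≤ lambdaMin (designMatrix M (fun i => X i ω) (S k)) ∧
            lambdaMax (designMatrix M (fun i => X i ω) (S k)) ≤ L := by
  set N : EuclideanSpace ℝ (Fin d) → ℝ := fun x => ∑ i, ∑ j, |M x i j| with hNdef
  have hNint : Integrable N μ :=
    integrable_finsetSum _ fun i _ => integrable_finsetSum _ fun j _ => (hint i j).abs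
  have hNmeas : Measurable N := by simp only [hNdef]; fun_prop
  have hN0 : 0 ≤ ∫ x, N x ∂μ := integral_nonneg fun x => by positivity
  set C : ℝ := ∫ x, N x ∂μ + 1 with hCdef
  have hC : 0 < C := by positivity
  have hδ (v : Fin p → ℝ) : ∃ δ : ℝ, 0 < δ ∧
      (v ⬝ᵥ v = 1 → μ.real {x | v ⬝ᵥ M x *ᵥ v ≤ δ} < ε / 2) := by
    by_cases hv : v ⬝ᵥ v = 1
    · obtain ⟨δ, h, h'⟩ := exists_measureReal_le_lt (measurable_dotProduct_mulVec hmeas v)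
        (fun x => (hpsd x).zero_le_quadratic v) (hnull v hv) (half_pos hε)
      exact ⟨δ, h, fun _ => h'⟩
    · exact ⟨1, one_pos, fun h => absurd h hv⟩
  choose δ hδ0 hδ using hδ
  obtain ⟨t, ht, hcover⟩ := (isCompact_dotProduct_self_eq_one p).elim_nhds_subcover
    (fun u => Metric.ball u (δ u * ε / (8 * C)))
    (fun u _ => Metric.ball_mem_nhds _ (by have := hδ0 u; positivity))
  -- Any small enough positive `ℓ` works, since the net is finite.
  obtain ⟨ℓ, hℓ0, hℓ⟩ : ∃ ℓ : ℝ, 0 < ℓ ∧ ∀ u ∈ t, ℓ ≤ δ u / 4 := by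
    have h : ∀ᶠ ℓ : ℝ in nhdsWithin 0 (Set.Ioi 0), ∀ u ∈ t, ℓ ≤ δ u / 4 :=
      (Finset.eventually_all t).2 fun u _ =>
        mem_nhdsWithin_of_mem_nhds (Iic_mem_nhds (by have := hδ0 u; positivity))
    obtain ⟨ℓ, h1, h2⟩ := (h.and self_mem_nhdsWithin).exists
    exact ⟨ℓ, h2, h1⟩
  refine ⟨ℓ, C / ε, hℓ0, fun Ω _ P X hX hindep => ?_⟩
  have hsetmeas (u : Fin p → ℝ) : MeasurableSet {y | u ⬝ᵥ M y *ᵥ u ≤ δ u} :=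
    measurableSet_le (measurable_dotProduct_mulVec hmeas u) measurable_const
  have hI : ∀ᵐ ω ∂P, ∀ u ∈ t, Tendsto (fun k : ℕ => (∑ i ∈ Finset.range k,
      {y | u ⬝ᵥ M y *ᵥ u ≤ δ u}.indicator (fun _ => (1 : ℝ)) (X i ω)) / k) atTop
      (nhds (∫ x, {y | u ⬝ᵥ M y *ᵥ u ≤ δ u}.indicator (fun _ => (1 : ℝ)) x ∂μ)) :=
    (ae_ball_iff t.countable_toSet).2 fun u _ => ae_tendsto_average hX hindep
      (measurable_const.indicator (hsetmeas u))
      ((integrable_const _).indicator (hsetmeas u))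
  filter_upwards [ae_tendsto_average hX hindep hNmeas hNint, hI] with ω hω hωI S hS hcard
  have hω' := hω.eventually_lt_const (by linarith : ∫ x, N x ∂μ < C)
  have hωI' : ∀ᶠ k : ℕ in atTop, ∀ u ∈ t, (∑ i ∈ Finset.range k,
      {y | u ⬝ᵥ M y *ᵥ u ≤ δ u}.indicator (fun _ => (1 : ℝ)) (X i ω)) / k < ε / 2 := by
    refine (Finset.eventually_all t).2 fun u hu => (hωI u hu).eventually_lt_const ?_
    rw [integral_indicator_const _ (hsetmeas u)]
    simpa using hδ u (ht u hu)
  filter_upwards [hω', hωI', hcard, eventually_gt_atTop 0] with k h1 h2 h3 hk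
  have hH := (posSemidef_designMatrix hpsd (fun i => X i ω) (S k)).isHermitian
  constructor
  · obtain ⟨v, hv, hve⟩ := exists_dotProduct_mulVec_eq_lambdaMin hp hH
    obtain ⟨u, hu, huv⟩ := Set.mem_iUnion₂.1 (hcover hv)
    rw [← hve]
    exact (hℓ u hu).trans (le_dotProduct_designMatrix_mulVec hpsd hε hC (hδ0 u) hk (hS k) h3 h1
      (ht u hu) hv (h2 u hu) (Metric.mem_ball.1 huv).le)
  · obtain ⟨v, hv, hve⟩ := exists_dotProduct_mulVec_eq_lambdaMax hp hH
    rw [← hve]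
    exact dotProduct_designMatrix_mulVec_le hε hC hk (hS k) h3 h1 hv

/-! ### Consequences of the hypothesis on `𝓜` -/

section Integration

variable {d p : ℕ} {𝒳 : Set (EuclideanSpace ℝ (Fin d))}
  {μ : Measure (EuclideanSpace ℝ (Fin d))}
  {𝓜 : EuclideanSpace ℝ (Fin d) → Matrix (Fin p) (Fin p) ℝ}

theorem sq_entry_le_frobeniusNorm_sq (A : Matrix (Fin p) (Fin p) ℝ) (i j : Fin p) :
    A i j ^ 2 ≤ frobeniusNorm A ^ 2 := by
  have h : (A * A.transpose).trace = ∑ i, ∑ j, A i j ^ 2 := by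
    simp [Matrix.trace, Matrix.mul_apply, sq]
  rw [frobeniusNorm, h, Real.sq_sqrt (by positivity)]
  exact (Finset.single_le_sum (f := fun j => A i j ^ 2) (fun _ _ => sq_nonneg _)
    (Finset.mem_univ j)).trans (Finset.single_le_sum (f := fun i => ∑ j, A i j ^ 2)
      (fun _ _ => by positivity) (Finset.mem_univ i))

theorem HypM.integrableOn_entry [IsFiniteMeasure μ] (hM : HypM 𝒳 μ 𝓜) (h𝒳 : MeasurableSet 𝒳)
    (i j : Fin p) : IntegrableOn (fun x => 𝓜 x i j) 𝒳 μ := by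
  have hmeas : AEStronglyMeasurable (fun x => 𝓜 x i j) (μ.restrict 𝒳) :=
    ContinuousOn.aestronglyMeasurable
      ((Continuous.matrix_elem continuous_id i j).comp_continuousOn hM.continuousOn) h𝒳
  refine MemLp.integrable one_le_two ((memLp_two_iff_integrable_sq hmeas).2 ⟨hmeas.pow 2, ?_⟩)
  obtain ⟨B, hB⟩ := hM.secondMoment
  refine lt_of_le_of_lt (lintegral_mono fun x => ?_) (hB.trans ENNReal.ofReal_lt_top)
  rw [Real.enorm_of_nonneg (sq_nonneg _)]
  exact ENNReal.ofReal_le_ofReal (sq_entry_le_frobeniusNorm_sq _ _ _)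

theorem dotProduct_infoMatrix_mulVec (hint : ∀ i j, Integrable (fun x => 𝓜 x i j) μ)
    (v : Fin p → ℝ) : v ⬝ᵥ infoMatrix 𝓜 μ *ᵥ v = ∫ x, v ⬝ᵥ 𝓜 x *ᵥ v ∂μ := by
  simp only [dotProduct_mulVec_eq_sum, infoMatrix, Matrix.of_apply]
  rw [integral_finsetSum _ fun i _ => integrable_finsetSum _ fun j _ => (hint i j).mul_const _]
  refine Finset.sum_congr rfl fun i _ => ?_
  rw [integral_finsetSum _ fun j _ => (hint i j).mul_const _]
  exact Finset.sum_congr rfl fun j _ => (integral_mul_const _ _).symm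

theorem posSemidef_infoMatrix (hpsd : ∀ᵐ x ∂μ, (𝓜 x).PosSemidef)
    (hint : ∀ i j, Integrable (fun x => 𝓜 x i j) μ) : (infoMatrix 𝓜 μ).PosSemidef := by
  refine Matrix.PosSemidef.of_dotProduct_mulVec_nonneg ?_ fun v => ?_
  · ext i j
    refine integral_congr_ae ?_
    filter_upwards [hpsd] with x hx
    simpa using hx.isHermitian.apply i j
  · rw [star_trivial, dotProduct_infoMatrix_mulVec hint]
    refine integral_nonneg_of_ae ?_
    filter_upwards [hpsd] with x hx using hx.zero_le_quadratic v

theorem HypM.measure_dotProduct_mulVec_eq_zero [IsFiniteMeasure μ] (hM : HypM 𝒳 μ 𝓜)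
    (h𝒳 : MeasurableSet 𝒳) (hpsd : ∀ x ∈ 𝒳, (𝓜 x).PosSemidef) {v : Fin p → ℝ} (hv : v ≠ 0)
    (hmeas : MeasurableSet (𝒳 ∩ {x | v ⬝ᵥ 𝓜 x *ᵥ v = 0})) :
    μ (𝒳 ∩ {x | v ⬝ᵥ 𝓜 x *ᵥ v = 0}) = 0 := by
  set A := 𝒳 ∩ {x | v ⬝ᵥ 𝓜 x *ᵥ v = 0}
  by_contra h
  obtain ⟨ℓ, hℓ, hA⟩ := hM.nondegenerate (μ.real A)
    (ENNReal.toReal_pos h (measure_ne_top _ _))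
  have hint (i j) : IntegrableOn (fun x => 𝓜 x i j) A μ :=
    (hM.integrableOn_entry h𝒳 i j).mono_set Set.inter_subset_left
  have h0 : v ⬝ᵥ infoMatrix 𝓜 (μ.restrict A) *ᵥ v = 0 := by
    rw [dotProduct_infoMatrix_mulVec hint]
    exact setIntegral_eq_zero_of_forall_eq_zero fun x hx => hx.2
  have hpsdA : (infoMatrix 𝓜 (μ.restrict A)).PosSemidef :=
    posSemidef_infoMatrix ((ae_restrict_iff' hmeas).2 (ae_of_all _ fun x hx => hpsd x hx.1)) hint
  exact absurd (hA A hmeas Set.inter_subset_left rfl)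
    (not_lt.2 ((lambdaMin_nonpos_of_dotProduct_mulVec_eq_zero hpsdA hv h0).trans hℓ.le))

end Integration

/-! ### The main theorem -/

theorem mainTheorem5 {d p : ℕ} (hp : 1 < p)
    (𝒳 : Set (EuclideanSpace ℝ (Fin d))) (h𝒳 : MeasurableSet 𝒳)
    (μ : Measure (EuclideanSpace ℝ (Fin d))) [IsProbabilityMeasure μ] (hμ : μ 𝒳ᶜ = 0)
    (𝓜 : EuclideanSpace ℝ (Fin d) → Matrix (Fin p) (Fin p) ℝ)
    (hpsd : ∀ x ∈ 𝒳, (𝓜 x).PosSemidef)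
    (hM : HypM 𝒳 μ 𝓜)
    (ε : ℝ) (hε : 0 < ε) :
    ∃ ℓ L : ℝ, 0 < ℓ ∧
      ∀ (Ω : Type*) [MeasurableSpace Ω] (P : Measure Ω) [IsProbabilityMeasure P]
        (X : ℕ → Ω → EuclideanSpace ℝ (Fin d)),
        (∀ i, HasLaw (X i) μ P) → iIndepFun X P →
        ∀ᵐ ω ∂P, ∀ S : ℕ → Finset ℕ,
          (∀ k, S k ⊆ Finset.range k) →
          (∀ᶠ k in atTop, ε < ((S k).card : ℝ) / (k : ℝ)) →
          (ℓ : EReal) <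
              liminf (fun k => (lambdaMin (designMatrix 𝓜 (fun i => X i ω) (S k)) : EReal)) atTop ∧
            limsup (fun k => (lambdaMax (designMatrix 𝓜 (fun i => X i ω) (S k)) : EReal)) atTop <
              (L : EReal) := by
  classical
  -- Off `𝒳`, `𝓜` is arbitrary; extending by 0 makes it measurable and semidefinite everywhere, and
  -- almost surely no sample point sees the change.
  have happ (x) (i j : Fin p) :
      𝒳.indicator 𝓜 x i j = 𝒳.indicator (fun x => 𝓜 x i j) x := by
    by_cases hx : x ∈ 𝒳 <;> simp [hx]
  have hpsd' (x) : (𝒳.indicator 𝓜 x).PosSemidef := by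
    by_cases hx : x ∈ 𝒳
    · simpa [hx] using hpsd x hx
    · simpa [hx] using Matrix.PosSemidef.zero
  have hmeas (i j : Fin p) : Measurable fun x => 𝒳.indicator 𝓜 x i j := by
    have hc : ContinuousOn (fun x => 𝓜 x i j) 𝒳 :=
      (Continuous.matrix_elem continuous_id i j).comp_continuousOn hM.continuousOn
    simp only [happ]
    rw [← Set.piecewise_eq_indicator]
    exact hc.measurable_piecewise continuousOn_const h𝒳
  have hint (i j : Fin p) : Integrable (fun x => 𝒳.indicator 𝓜 x i j) μ := by
    simp only [happ]
    exact (hM.integrableOn_entry h𝒳 i j).integrable_indicator h𝒳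
  have hnull (v : Fin p → ℝ) (hv : v ⬝ᵥ v = 1) :
      μ {x | v ⬝ᵥ 𝒳.indicator 𝓜 x *ᵥ v = 0} = 0 := by
    have heq : 𝒳 ∩ {x | v ⬝ᵥ 𝒳.indicator 𝓜 x *ᵥ v = 0} =
        𝒳 ∩ {x | v ⬝ᵥ 𝓜 x *ᵥ v = 0} := by
      ext x
      by_cases hx : x ∈ 𝒳 <;> simp [hx]
    have h := hM.measure_dotProduct_mulVec_eq_zero h𝒳 hpsd
      (v := v) (by rintro rfl; simp at hv) (heq ▸ h𝒳.inter
        (measurableSet_eq_fun (measurable_dotProduct_mulVec hmeas v) measurable_const))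
    refine measure_mono_null (fun x hx => ?_) (measure_union_null h hμ)
    by_cases h' : x ∈ 𝒳
    · exact Or.inl (heq ▸ ⟨h', hx⟩)
    · exact Or.inr h'
  obtain ⟨ℓ, L, hℓ, h⟩ := exists_bounds_designMatrix (zero_lt_one.trans hp) hpsd' hmeas hint
    hnull hε
  -- Eventual bounds pass to the limits only as weak inequalities; the slack restores strictness.
  refine ⟨ℓ / 2, L + 1, half_pos hℓ, fun Ω _ P _ X hX hindep => ?_⟩
  have hmem : ∀ᵐ ω ∂P, ∀ i, X i ω ∈ 𝒳 :=
    ae_all_iff.2 fun i => ((hX i).ae_iff (p := (· ∈ 𝒳)) h𝒳.mem).2 (mem_ae_iff.2 hμ)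
  filter_upwards [h Ω P X hX hindep, hmem] with ω hω hωmem S hS hcard
  have hev := hω S hS hcard
  have hD (k) : designMatrix (𝒳.indicator 𝓜) (fun i => X i ω) (S k) =
      designMatrix 𝓜 (fun i => X i ω) (S k) := by
    simp only [designMatrix, Set.indicator_of_mem (hωmem _)]
  simp only [hD] at hev
  constructor
  · refine lt_of_lt_of_le (EReal.coe_lt_coe_iff.2 (half_lt_self hℓ)) (le_liminf_of_le ?_ ?_)
    · isBoundedDefault
    · exact hev.mono fun k hk => EReal.coe_le_coe_iff.2 hk.1
  · refine lt_of_le_of_lt (limsup_le_of_le ?_ ?_) (EReal.coe_lt_coe_iff.2 (lt_add_one L))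
    · isBoundedDefault
    · exact hev.mono fun k hk => EReal.coe_le_coe_iff.2 hk.2
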